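/- A \emph{time-labeling} of a finite simple undirected graph $G=(V,E)$ is a function $\lambda:E\to 2^{\mathbb N}$, and its size is $|\lambda|=\sum_{e\in E}|\lambda(e)|$. A \emph{temporal path} from $u$ to $v$ in $(G,\lambda)$ is a path in $G$ from $u$ to $v$ with consecutive edges $e_1,\dots,e_k$, together with times $t_i\in\lambda(e_i)$ such that $t_1<t_2<\dots<t_k$. The pair $(G,\lambda)$ is \emph{temporally connected} if for every two distinct vertices $u,v\in V$ there is a temporal path from $u$ to $v$ (and hence also one from $v$ to $u$). Theorem 1. Let $G=(V,E)$ be a connected graph on $n\ge 2$ vertices. Then the smallest $k\in\mathbb N$ for which there exists a time-labeling $\lambda$ of $G$ such that $|\lambda|\le k$ and $(G,\lambda)$ is temporally connected is \[ k=\begin{cases}2n-4,&\text{if $G$ contains the $4$-cycle $C_4$ as a (not necessarily induced) subgraph,}\\ 2n-3,&\text{otherwise.}\end{cases} \] -/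

import Mathlib

namespace TemporalGraph

variable {V : Type*} {G : SimpleGraph V}

/-- A time-labeling of `G`: every edge receives a set of discrete time-labels. The pair of `G`
and a time-labeling is a temporal graph. -/
abbrev Labeling (G : SimpleGraph V) : Type _ := G.edgeSet → Set ℕ

/-- `t ∈ λ(e)`: the edge `e` of `G` is active at time `t`. -/
def Labeling.Active (lam : Labeling G) (e : Sym2 V) (t : ℕ) : Prop :=
  ∃ he : e ∈ G.edgeSet, t ∈ lam ⟨e, he⟩

/-- The cost `|λ| = ∑_{e ∈ E} |λ(e)|`, the total number of time-labels (possibly infinite). -/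
noncomputable def Labeling.cost [Fintype G.edgeSet] (lam : Labeling G) : ℕ∞ :=
  ∑ e : G.edgeSet, (lam e).encard

/-- The edges `e₁, …, e_k` of the walk `p`, with the times `ts = [t₁, …, t_k]`, form a temporal
path: `p` is a path of `G`, `t₁ < ⋯ < t_k`, and `tᵢ ∈ λ(eᵢ)` for every `i`. -/
structure IsTemporalPath (lam : Labeling G) {u v : V} (p : G.Walk u v) (ts : List ℕ) : Prop where
  isPath : p.IsPath
  strictlyIncreasing : ts.Pairwise (· < ·)
  active : List.Forall₂ lam.Active p.edges ts

/-- `v` is temporally reachable from `u`. -/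
def Reachable (lam : Labeling G) (u v : V) : Prop :=
  ∃ (p : G.Walk u v) (ts : List ℕ), IsTemporalPath lam p ts

/-- Every vertex is temporally reachable from every other vertex. -/
def TemporallyConnected (lam : Labeling G) : Prop :=
  ∀ u v : V, u ≠ v → Reachable lam u v

/-- `(G, k)` is a yes-instance of Min. Labeling: some time-labeling with at most `k` labels in
total makes `G` temporally connected. -/
def MinLabelingYes (G : SimpleGraph V) [Fintype G.edgeSet] (k : ℕ) : Prop :=
  ∃ lam : Labeling G, TemporallyConnected lam ∧ lam.cost ≤ k

end TemporalGraph

/-! ### Sequences of two-way calls. -/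

namespace TemporalGraph

/-! This is the gossip problem with calls confined to the edges of `G`. Sorting labels by time, with
ties broken arbitrarily, turns a labeling into a call sequence (`exists_calls_of_labeling`);
numbering calls goes back (`minLabelingYes_of_calls`). For the upper bound, every vertex attached to
a set that already exchanges everything costs one call before and one after; start from an edge with
one call or a 4-cycle with four.

The lower bound `card_add_card_le` is stated for sources `U` and sinks `W`, a form that survives
induction. In a counterexample, consider early parts `F` of a scheme that leave the sources split by
a closed set `A`. Induction on both sides of `A` gives `|F| ≤ |U| - 2`, and the first `|U| - 2`
calls always qualify. Fix such an extremal `F`, with remainder `L`, having fewest sources in `A`. A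
call of `L` disjoint from the earlier calls of `L` must cross `A`, by extremality, and must meet the
last early call `e` inside `A`, by minimality. (If `A` contains no early call, it must meet the only
source in `A`.) So `L` has at most `|L| + 2` participants, while all sinks take part and `|W| = |L|
+ β - 1`. This refutes `β = 4`.

For `β = 3` everything is tight, so in `L` the ends of `e` talk only to newcomers and hear only what
these learned in `F`. Then `exists_call_between` yields an early call outside `A` between a partner
of `e.1` and a partner of `e.2`, which closes a 4-cycle with `e`. -/

/-- In a sequence of two-way calls, made in the order of the list, the information of `u` reaches
`w`. -/
def CallReach {V : Type*} : List (V × V) → V → V → Prop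
  | [], u, w => u = w
  | c :: l, u, w =>
    CallReach l u w ∨ (u = c.1 ∧ CallReach l c.2 w) ∨ (u = c.2 ∧ CallReach l c.1 w)

namespace CallReach

variable {V : Type*} {l l' : List (V × V)} {c d : V × V} {u v w : V}

theorem refl (l : List (V × V)) (u : V) : CallReach l u u := by
  induction l with
  | nil => rfl
  | cons c l ih => exact Or.inl ih

theorem append_iff : CallReach (l ++ l') u w ↔ ∃ z, CallReach l u z ∧ CallReach l' z w := by
  induction l generalizing u with
  | nil => simp [CallReach]
  | cons c l ih =>
    simp only [List.cons_append, CallReach, ih]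
    constructor
    · rintro (⟨z, h, h'⟩ | ⟨rfl, z, h, h'⟩ | ⟨rfl, z, h, h'⟩)
      · exact ⟨z, Or.inl h, h'⟩
      · exact ⟨z, Or.inr (Or.inl ⟨rfl, h⟩), h'⟩
      · exact ⟨z, Or.inr (Or.inr ⟨rfl, h⟩), h'⟩
    · rintro ⟨z, h | ⟨rfl, h⟩ | ⟨rfl, h⟩, h'⟩
      · exact Or.inl ⟨z, h, h'⟩
      · exact Or.inr (Or.inl ⟨rfl, z, h, h'⟩)
      · exact Or.inr (Or.inr ⟨rfl, z, h, h'⟩)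

theorem of_mem (h : (u, w) ∈ l) : CallReach l u w := by
  induction l with
  | nil => simp at h
  | cons c l ih =>
    rcases List.mem_cons.1 h with rfl | h
    · exact Or.inr (Or.inl ⟨rfl, refl _ _⟩)
    · exact Or.inl (ih h)

theorem of_mem_symm (h : (w, u) ∈ l) : CallReach l u w := by
  induction l with
  | nil => simp at h
  | cons c l ih =>
    rcases List.mem_cons.1 h with rfl | h
    · exact Or.inr (Or.inr ⟨rfl, refl _ _⟩)
    · exact Or.inl (ih h)

/-- The two calls have no participant in common. -/
def _root_.TemporalGraph.CallDisjoint (c d : V × V) : Prop :=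
  c.1 ≠ d.1 ∧ c.1 ≠ d.2 ∧ c.2 ≠ d.1 ∧ c.2 ≠ d.2

theorem swap (h : CallDisjoint c d) (hr : CallReach (c :: d :: l) u w) :
    CallReach (d :: c :: l) u w := by
  obtain ⟨h1, h2, h3, h4⟩ := h
  simp only [CallReach] at hr ⊢
  grind

theorem cons_mono (h : ∀ u, CallReach l u w → CallReach l' u w) (hr : CallReach (c :: l) u w) :
    CallReach (c :: l') u w :=
  hr.imp (h _) (Or.imp (And.imp_right (h _)) (And.imp_right (h _)))

/-- A call may be made earlier than calls it has no participant in common with. -/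
theorem move_front {l l' : List (V × V)} (h : ∀ c ∈ l, CallDisjoint c d)
    (hr : CallReach (l ++ d :: l') u w) : CallReach (d :: (l ++ l')) u w := by
  induction l generalizing u with
  | nil => exact hr
  | cons c l ih =>
    exact swap (h c (by simp))
      (cons_mono (l := l ++ d :: l') (fun u => ih fun c hc => h c (by simp [hc])) hr)

theorem append_left (h : CallReach l u w) : CallReach (l ++ l') u w :=
  append_iff.2 ⟨w, h, refl _ _⟩

theorem append_right (h : CallReach l' u w) : CallReach (l ++ l') u w :=
  append_iff.2 ⟨u, refl _ _, h⟩

theorem append_mono_left {l₁ l₂ : List (V × V)} (h : ∀ z, CallReach l₁ u z → CallReach l₂ u z)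
    (hr : CallReach (l₁ ++ l) u w) : CallReach (l₂ ++ l) u w := by
  obtain ⟨z, h1, h2⟩ := append_iff.1 hr
  exact append_iff.2 ⟨z, h z h1, h2⟩

theorem append_mono_right {l₁ l₂ : List (V × V)} (h : ∀ z, CallReach l₁ z w → CallReach l₂ z w)
    (hr : CallReach (l ++ l₁) u w) : CallReach (l ++ l₂) u w := by
  obtain ⟨z, h1, h2⟩ := append_iff.1 hr
  exact append_iff.2 ⟨z, h1, h z h2⟩

end CallReach

/-! ### Closed sets of people and connectivity. -/

section Closed

variable {V : Type*} {l l' : List (V × V)} {A : Set V} {u v w : V}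

/-- No call of `l` crosses the boundary of `A`. -/
def CallClosed (l : List (V × V)) (A : Set V) : Prop := ∀ c ∈ l, c.1 ∈ A ↔ c.2 ∈ A

theorem CallClosed.compl (h : CallClosed l A) : CallClosed l Aᶜ :=
  fun c hc => not_congr (h c hc)

theorem CallClosed.reach (h : CallClosed l A) (hr : CallReach l u w) : u ∈ A ↔ w ∈ A := by
  induction l generalizing u with
  | nil => rw [show u = w from hr]
  | cons c l ih =>
    have hc := h c (by simp)
    have h' : CallClosed l A := fun c hc => h c (by simp [hc])
    rcases hr with hr | ⟨rfl, hr⟩ | ⟨rfl, hr⟩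
    · exact ih h' hr
    · exact hc.trans (ih h' hr)
    · exact hc.symm.trans (ih h' hr)

open Classical in
/-- The calls of `l` that take place inside `A`. -/
noncomputable def callsIn (l : List (V × V)) (A : Set V) : List (V × V) :=
  l.filter fun c => c.1 ∈ A

theorem mem_callsIn {c : V × V} : c ∈ callsIn l A ↔ c ∈ l ∧ c.1 ∈ A := by
  simp [callsIn]

theorem length_callsIn_add (l : List (V × V)) (A : Set V) :
    (callsIn l A).length + (callsIn l Aᶜ).length = l.length := by
  classical
  induction l with
  | nil => simp [callsIn]
  | cons c l ih =>
    simp only [callsIn] at ih ⊢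
    by_cases hc : c.1 ∈ A <;> simp [hc] at ih ⊢ <;> omega

theorem CallClosed.reach_callsIn (h : CallClosed l A) (hu : u ∈ A) (hr : CallReach l u w) :
    CallReach (callsIn l A) u w := by
  classical
  induction l generalizing u with
  | nil => exact hr
  | cons c l ih =>
    have hc := h c (by simp)
    have h' : CallClosed l A := fun c hc => h c (by simp [hc])
    by_cases hcA : c.1 ∈ A
    · have : callsIn (c :: l) A = c :: callsIn l A := by simp [callsIn, hcA]
      rw [this]
      rcases hr with hr | ⟨rfl, hr⟩ | ⟨rfl, hr⟩
      · exact Or.inl (ih h' hu hr)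
      · exact Or.inr (Or.inl ⟨rfl, ih h' (hc.1 hcA) hr⟩)
      · exact Or.inr (Or.inr ⟨rfl, ih h' hcA hr⟩)
    · have : callsIn (c :: l) A = callsIn l A := by simp [callsIn, hcA]
      rw [this]
      rcases hr with hr | ⟨rfl, hr⟩ | ⟨rfl, hr⟩
      · exact ih h' hu hr
      · exact absurd hu hcA
      · exact absurd (hc.2 hu) hcA

/-- Calls on both sides of a closed set may be reordered so that those inside come last. -/
theorem CallClosed.reach_reorder (h : CallClosed l A) (hr : CallReach l u w) :
    CallReach (callsIn l Aᶜ ++ callsIn l A) u w := by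
  by_cases hu : u ∈ A
  · exact (h.reach_callsIn hu hr).append_right
  · exact (h.compl.reach_callsIn hu hr).append_left

/-- Fewer than `|U| - 1` calls leave `U` disconnected. -/
theorem exists_callClosed_split [DecidableEq V] (l : List (V × V)) (U : Finset V)
    (h : l.length + 1 < U.card) :
    ∃ A : Set V, CallClosed l A ∧ (∃ u ∈ U, u ∈ A) ∧ ∃ u ∈ U, u ∉ A := by
  induction hn : l.length generalizing l U with
  | zero =>
    obtain rfl := List.length_eq_zero_iff.1 hn
    obtain ⟨a, ha, b, hb, hab⟩ := Finset.one_lt_card.1 (show 1 < U.card by omega)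
    exact ⟨{a}, fun c hc => by simp at hc, ⟨a, ha, rfl⟩, b, hb, fun hb => hab hb.symm⟩
  | succ n ih =>
    obtain _ | ⟨c, l⟩ := l
    · simp at hn
    -- Contract the first call: this loses at most one element of `U`, and a closed set of the
    -- contracted calls pulls back to one containing both or neither of its participants.
    let f : V → V := fun v => if v = c.2 then c.1 else v
    have hcard : U.card ≤ (U.image f).card + 1 := by
      have hsub : U.erase c.2 ⊆ U.image f := by
        intro v hv
        rw [Finset.mem_erase] at hv
        exact Finset.mem_image.2 ⟨v, hv.2, by simp [f, hv.1]⟩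
      have := Finset.card_le_card hsub
      have := Finset.pred_card_le_card_erase (s := U) (a := c.2)
      omega
    simp only [List.length_cons] at h hn
    obtain ⟨A, hA, ⟨a, ha, haA⟩, b, hb, hbA⟩ :=
      ih (l.map (Prod.map f f)) (U.image f) (by simp; omega) (by simp; omega)
    obtain ⟨a, haU, rfl⟩ := Finset.mem_image.1 ha
    obtain ⟨b, hbU, rfl⟩ := Finset.mem_image.1 hb
    refine ⟨f ⁻¹' A, ?_, ⟨a, haU, haA⟩, b, hbU, hbA⟩
    intro d hd
    rcases List.mem_cons.1 hd with rfl | hd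
    · have : f d.1 = f d.2 := by simp only [f]; split_ifs <;> simp_all
      simp [this]
    · exact hA (Prod.map f f d) (List.mem_map_of_mem hd)

/-- If there are fewer than `|T| - 1` calls, all inside `A ⊇ T`, then some part of `A` that avoids a
given person is closed and splits `T`. -/
theorem exists_callClosed_subset [DecidableEq V] {T : Finset V} (hl : ∀ c ∈ l, c.1 ∈ A ∧ c.2 ∈ A)
    (hT : ∀ x ∈ T, x ∈ A) (h : l.length + 1 < T.card) (r : V) :
    ∃ A' ⊆ A, CallClosed l A' ∧ r ∉ A' ∧ (∃ a ∈ T, a ∈ A') ∧ ∃ b ∈ T, b ∉ A' := by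
  obtain ⟨B, hB, ⟨x, hx, hxB⟩, y, hy, hyB⟩ := exists_callClosed_split l T h
  by_cases hr : r ∈ B
  · refine ⟨A \ B, Set.sdiff_subset, fun c hc => ?_, fun h => h.2 hr, ⟨y, hy, hT y hy, hyB⟩,
      x, hx, fun h => h.2 hxB⟩
    exact and_congr (iff_of_true (hl c hc).1 (hl c hc).2) (not_congr (hB c hc))
  · refine ⟨A ∩ B, Set.inter_subset_left, fun c hc => ?_, fun h => hr h.2, ⟨x, hx, hT x hx, hxB⟩,
      y, hy, fun h => hyB h.2⟩
    exact and_congr (iff_of_true (hl c hc).1 (hl c hc).2) (hB c hc)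

open Classical in
/-- The members of `T` that lie in `A`. -/
noncomputable def membersIn (T : Finset V) (A : Set V) : Finset V := T.filter fun x => x ∈ A

theorem mem_membersIn {T : Finset V} {x : V} : x ∈ membersIn T A ↔ x ∈ T ∧ x ∈ A := by
  simp [membersIn]

theorem card_membersIn_add (T : Finset V) (A : Set V) :
    (membersIn T A).card + (membersIn T Aᶜ).card = T.card := by
  classical
  rw [← Finset.card_filter_add_card_filter_not (s := T) (fun x => x ∈ A)]
  unfold membersIn
  congr!

end Closed

end TemporalGraph

namespace TemporalGraph

/-! ### A call between two sets that everybody reaches. -/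

section Between

variable {V : Type*}

open Classical in
/-- Let `T` be a set of more people than there are calls, each of whom reaches both of the disjoint
sets `D₁` and `D₂`. Then there is a call between `D₁` and `D₂`. -/
theorem exists_call_between (F : List (V × V)) (T : Finset V) (D₁ D₂ : Set V)
    (hD : Disjoint D₁ D₂) (hc : F.length < T.card)
    (h₁ : ∀ x ∈ T, ∃ z ∈ D₁, CallReach F x z) (h₂ : ∀ x ∈ T, ∃ z ∈ D₂, CallReach F x z) :
    ∃ c ∈ F, (c.1 ∈ D₁ ∧ c.2 ∈ D₂) ∨ (c.1 ∈ D₂ ∧ c.2 ∈ D₁) := by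
  induction hn : T.card using Nat.strong_induction_on generalizing T F with
  | _ n ih =>
  subst hn
  by_contra hcon
  -- One side of a closed set splitting `T` still has more members of `T` than calls, so induction
  -- applies there.
  have hsplit : ∀ C : Set V, CallClosed F C → (∃ x ∈ T, x ∈ C) → (∃ x ∈ T, x ∉ C) → False := by
    intro C hC ⟨x, hx, hxC⟩ ⟨y, hy, hyC⟩
    have hl := length_callsIn_add F C
    have hcard := card_membersIn_add T C
    have hpos₁ : 0 < (membersIn T C).card :=
      Finset.card_pos.2 ⟨x, mem_membersIn.2 ⟨hx, hxC⟩⟩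
    have hpos₂ : 0 < (membersIn T Cᶜ).card :=
      Finset.card_pos.2 ⟨y, mem_membersIn.2 ⟨hy, hyC⟩⟩
    have aux : ∀ C : Set V, CallClosed F C →
        (callsIn F C).length < (membersIn T C).card →
        (membersIn T C).card < T.card → False := by
      intro C hC hlt hlt'
      obtain ⟨c, hcF, hc⟩ := ih _ hlt' (callsIn F C) (membersIn T C) hlt
        (fun x hx => by
          rw [mem_membersIn] at hx
          obtain ⟨z, hz, hr⟩ := h₁ x hx.1
          exact ⟨z, hz, hC.reach_callsIn hx.2 hr⟩)
        (fun x hx => by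
          rw [mem_membersIn] at hx
          obtain ⟨z, hz, hr⟩ := h₂ x hx.1
          exact ⟨z, hz, hC.reach_callsIn hx.2 hr⟩) rfl
      exact hcon ⟨c, (mem_callsIn.1 hcF).1, hc⟩
    by_cases hlt : (callsIn F C).length < (membersIn T C).card
    · exact aux C hC hlt (by omega)
    · exact aux Cᶜ hC.compl (by omega) (by omega)
  obtain ⟨x₀, hx₀⟩ : T.Nonempty := Finset.card_pos.1 (by omega)
  rcases List.eq_nil_or_concat' F with rfl | ⟨F, g, rfl⟩
  · obtain ⟨z, hz, rfl⟩ := h₁ x₀ hx₀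
    obtain ⟨z', hz', h⟩ := h₂ _ hx₀
    obtain rfl : x₀ = z' := h
    exact Set.disjoint_left.1 hD hz hz'
  have hlen : F.length + 1 < T.card := by simpa using hc
  obtain ⟨C, hC, hCT, hCT'⟩ := exists_callClosed_split F T hlen
  -- With fewer calls the side would fall apart, and a piece avoiding the endpoint of `g` would stay
  -- closed under `g`, against `hsplit`.
  have hconn : ∀ (C : Set V) (x y : V), CallClosed F C → x ∈ C → y ∉ C →
      (g = (x, y) ∨ g = (y, x)) →
      (membersIn T C).card ≤ (callsIn F C).length + 1 := by
    intro C x y hC hx hy hg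
    by_contra! hlt
    obtain ⟨B, hBC, hB, hxB, ⟨b, hb, hbB⟩, b', hb', hbB'⟩ :=
      exists_callClosed_subset (l := callsIn F C) (A := C)
        (fun c hc => ⟨(mem_callsIn.1 hc).2, (hC c (mem_callsIn.1 hc).1).1 (mem_callsIn.1 hc).2⟩)
        (fun x hx => (mem_membersIn.1 hx).2) hlt x
    have hyB : y ∉ B := fun h => hy (hBC h)
    refine hsplit B ?_ ⟨b, (mem_membersIn.1 hb).1, hbB⟩ ⟨b', (mem_membersIn.1 hb').1, hbB'⟩
    intro c hc
    rcases List.mem_append.1 hc with hc | hc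
    · by_cases hcC : c.1 ∈ C
      · exact hB c (mem_callsIn.2 ⟨hc, hcC⟩)
      · exact iff_of_false (fun h => hcC (hBC h)) (fun h => hcC ((hC c hc).2 (hBC h)))
    · obtain rfl := List.mem_singleton.1 hc
      rcases hg with rfl | rfl
      exacts [iff_of_false hxB hyB, iff_of_false hyB hxB]
  -- By induction some member of `T` in `C` misses one `Dᵢ` within `C`. Only the last call `g` can
  -- help it, so it reaches `x`, and `y ∈ Dᵢ`.
  have hside : ∀ (C : Set V) (x y : V), CallClosed F C → x ∈ C → y ∉ C →
      (g = (x, y) ∨ g = (y, x)) → (callsIn F C).length < (membersIn T C).card →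
      (membersIn T C).card < T.card →
      ∃ z, CallReach (callsIn F C) z x ∧
        ((y ∈ D₁ ∧ ∀ d ∈ D₁, ¬ CallReach (callsIn F C) z d) ∨
          (y ∈ D₂ ∧ ∀ d ∈ D₂, ¬ CallReach (callsIn F C) z d)) := by
    intro C x y hC hx hy hg hlt hlt'
    have aux : ∀ D : Set V, (∀ x ∈ T, ∃ z ∈ D, CallReach (F ++ [g]) x z) →
        ∀ z ∈ membersIn T C, (¬ ∃ d ∈ D, CallReach (callsIn F C) z d) →
        CallReach (callsIn F C) z x ∧ y ∈ D := by
      intro D hD z hz hno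
      rw [mem_membersIn] at hz
      obtain ⟨d, hd, hr⟩ := hD z hz.1
      obtain ⟨d', hr', hr''⟩ := CallReach.append_iff.1 hr
      have hd' : d' ∈ C := (hC.reach hr').1 hz.2
      have hin := hC.reach_callsIn hz.2 hr'
      simp only [CallReach] at hr''
      rcases hr'' with rfl | ⟨rfl, rfl⟩ | ⟨rfl, rfl⟩
      · exact absurd ⟨d', hd, hin⟩ hno
      · rcases hg with rfl | rfl
        · exact ⟨hin, hd⟩
        · exact absurd hd' hy
      · rcases hg with rfl | rfl
        · exact absurd hd' hy
        · exact ⟨hin, hd⟩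
    by_contra hno
    have hall : ∀ z ∈ membersIn T C,
        (∃ d ∈ D₁, CallReach (callsIn F C) z d) ∧ ∃ d ∈ D₂, CallReach (callsIn F C) z d := by
      intro z hz
      constructor
      · by_contra h
        obtain ⟨hr, hyD⟩ := aux D₁ h₁ z hz h
        exact hno ⟨z, hr, Or.inl ⟨hyD, fun d hd hr => h ⟨d, hd, hr⟩⟩⟩
      · by_contra h
        obtain ⟨hr, hyD⟩ := aux D₂ h₂ z hz h
        exact hno ⟨z, hr, Or.inr ⟨hyD, fun d hd hr => h ⟨d, hd, hr⟩⟩⟩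
    obtain ⟨c, hcF, hc⟩ := ih _ hlt' (callsIn F C) (membersIn T C) hlt
      (fun z hz => (hall z hz).1) (fun z hz => (hall z hz).2) rfl
    exact hcon ⟨c, List.mem_append_left _ (mem_callsIn.1 hcF).1, hc⟩
  obtain ⟨s, t, hs, ht, hg⟩ : ∃ s t, s ∈ C ∧ t ∉ C ∧ (g = (s, t) ∨ g = (t, s)) := by
    by_contra hno
    refine hsplit C ?_ hCT hCT'
    intro c hc
    rcases List.mem_append.1 hc with hc | hc
    · exact hC c hc
    · obtain rfl := List.mem_singleton.1 hc
      by_contra hne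
      by_cases h : c.1 ∈ C
      · exact hno ⟨c.1, c.2, h, by tauto, Or.inl rfl⟩
      · exact hno ⟨c.2, c.1, by tauto, h, Or.inr rfl⟩
  have ht' : t ∈ Cᶜ := ht
  have hs' : s ∉ Cᶜ := fun h => h hs
  have hl := length_callsIn_add F C
  have hcard := card_membersIn_add T C
  have hc₁ := hconn C s t hC hs ht hg
  have hc₂ := hconn Cᶜ t s hC.compl ht' hs' hg.symm
  obtain ⟨z, hz, hz'⟩ := hside C s t hC hs ht hg (by omega) (by omega)
  obtain ⟨y, hy, hy'⟩ := hside Cᶜ t s hC.compl ht' hs' hg.symm (by omega) (by omega)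
  have hgm : g ∈ F ++ [g] := by simp
  -- If both sides miss the same `Dᵢ`, then `y` reaches `t ∈ Dᵢ` on its own side, a contradiction;
  -- otherwise `g` joins `D₁` to `D₂`.
  rcases hz' with ⟨htD, hz'⟩ | ⟨htD, hz'⟩ <;> rcases hy' with ⟨hsD, hy'⟩ | ⟨hsD, hy'⟩
  · exact hy' t htD hy
  · rcases hg with rfl | rfl
    · exact hcon ⟨_, hgm, Or.inr ⟨hsD, htD⟩⟩
    · exact hcon ⟨_, hgm, Or.inl ⟨htD, hsD⟩⟩
  · rcases hg with rfl | rfl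
    · exact hcon ⟨_, hgm, Or.inl ⟨hsD, htD⟩⟩
    · exact hcon ⟨_, hgm, Or.inr ⟨htD, hsD⟩⟩
  · exact hy' t htD hy

end Between

/-! ### Counting participants. -/

section Participants

variable {V : Type*} [DecidableEq V] {l : List (V × V)} {p z w : V} {Q : Finset V}

/-- The people who take part in some call of `l`. -/
def participants : List (V × V) → Finset V
  | [] => ∅
  | c :: l => insert c.1 (insert c.2 (participants l))

theorem mem_participants : z ∈ participants l ↔ ∃ c ∈ l, z = c.1 ∨ z = c.2 := by
  induction l with
  | nil => simp [participants]
  | cons c l ih => simp [participants, ih, or_assoc]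

theorem participants_concat (l : List (V × V)) (c : V × V) :
    participants (l ++ [c]) = insert c.1 (insert c.2 (participants l)) := by
  ext z
  simp only [mem_participants, Finset.mem_insert, List.mem_append, List.mem_singleton]
  grind

theorem eq_of_callReach_of_notMem_right (hw : w ∉ participants l) (h : CallReach l z w) :
    z = w := by
  induction l generalizing z with
  | nil => exact h
  | cons c l ih =>
    simp only [participants, Finset.mem_insert, not_or] at hw
    rcases h with h | ⟨-, h⟩ | ⟨-, h⟩
    · exact ih hw.2.2 h
    · exact absurd (ih hw.2.2 h).symm hw.2.1
    · exact absurd (ih hw.2.2 h).symm hw.1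

/-- `Q` meets every call of `l` that has no participant in common with the earlier ones. -/
def MeetsInitial {V : Type*} (l : List (V × V)) (Q : Finset V) : Prop :=
  ∀ X c Y, l = X ++ c :: Y → (∀ d ∈ X, CallDisjoint d c) → c.1 ∈ Q ∨ c.2 ∈ Q

theorem MeetsInitial.of_append {V : Type*} {X Y : List (V × V)} {Q : Finset V}
    (h : MeetsInitial (X ++ Y) Q) : MeetsInitial X Q := by
  rintro X' c Y' rfl hd
  exact h X' c (Y' ++ Y) (by simp) hd

/-- A call brings two newcomers only if it is disjoint from all earlier ones, and then one of them
lies in `Q`. -/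
theorem MeetsInitial.card_concat_le {X : List (V × V)} {c : V × V}
    (h : MeetsInitial (X ++ [c]) Q) :
    (participants (X ++ [c])).card + (Q ∩ participants X).card ≤
      (participants X).card + 1 + (Q ∩ participants (X ++ [c])).card := by
  rw [participants_concat]
  have hmono : (Q ∩ participants X).card ≤
      (Q ∩ insert c.1 (insert c.2 (participants X))).card :=
    Finset.card_le_card (by intro; simp; tauto)
  have ha := Finset.card_insert_le c.1 (insert c.2 (participants X))
  have hb := Finset.card_insert_le c.2 (participants X)
  by_cases h1 : c.1 ∈ participants X
  · rw [Finset.insert_eq_of_mem (Finset.mem_insert_of_mem h1)] at *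
    omega
  by_cases h2 : c.2 ∈ participants X
  · rw [Finset.insert_eq_of_mem h2] at *
    omega
  have hQ := h X c [] rfl (by
    intro d hd
    simp only [mem_participants, not_exists, not_and, not_or] at h1 h2
    exact ⟨fun e => (h1 d hd).1 e.symm, fun e => (h2 d hd).1 e.symm,
      fun e => (h1 d hd).2 e.symm, fun e => (h2 d hd).2 e.symm⟩)
  have hlt : (Q ∩ participants X).card <
      (Q ∩ insert c.1 (insert c.2 (participants X))).card := by
    apply Finset.card_lt_card
    refine ⟨by intro; simp; tauto, fun hsub => ?_⟩
    rcases hQ with hQ | hQ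
    · exact h1 (Finset.mem_inter.1 (hsub (by simp [hQ]))).2
    · exact h2 (Finset.mem_inter.1 (hsub (by simp [hQ]))).2
  omega

theorem MeetsInitial.card_append_le {X Y : List (V × V)} (h : MeetsInitial (X ++ Y) Q) :
    (participants (X ++ Y)).card + (Q ∩ participants X).card ≤
      (participants X).card + Y.length + (Q ∩ participants (X ++ Y)).card := by
  induction Y generalizing X with
  | nil => simp
  | cons c Y ih =>
    rw [List.append_cons] at h ⊢
    have := ih h
    have := h.of_append.card_concat_le
    simp only [List.length_cons]
    omega

theorem MeetsInitial.card_le (h : MeetsInitial l Q) :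
    (participants l).card ≤ l.length + (Q ∩ participants l).card := by
  simpa [participants] using MeetsInitial.card_append_le (X := []) (Y := l) h

/-- When `l` has as many participants as possible, the people in `Q` talk only to people who did
not take part in any call before. -/
theorem MeetsInitial.notMem_of_tight {X Y : List (V × V)} {c : V × V}
    (h : MeetsInitial (X ++ c :: Y) Q)
    (htight : X.length + (Y.length + 1) + Q.card ≤ (participants (X ++ c :: Y)).card) :
    (c.1 ∈ Q → c.2 ∉ participants X) ∧ (c.2 ∈ Q → c.1 ∉ participants X) := by
  have hX := h.of_append.card_le
  rw [List.append_cons] at h htight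
  have hY := h.card_append_le
  have hQ : (Q ∩ participants (X ++ [c] ++ Y)).card ≤ Q.card :=
    Finset.card_le_card Finset.inter_subset_left
  -- Tightness allows no wasted call: each must gain one participant more than it gains members of
  -- `Q`.
  have hstep : ¬ (participants (X ++ [c])).card + (Q ∩ participants X).card ≤
      (participants X).card + (Q ∩ participants (X ++ [c])).card := by
    intro hle
    omega
  rw [participants_concat] at hstep
  have hmono : (Q ∩ participants X).card ≤
      (Q ∩ insert c.1 (insert c.2 (participants X))).card :=
    Finset.card_le_card (by intro; simp; tauto)
  have hnew : ∀ a ∈ Q, a ∉ participants X →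
      (insert a (participants X)).card + (Q ∩ participants X).card ≤
        (participants X).card + (Q ∩ insert a (participants X)).card := by
    intro a haQ ha
    rw [Finset.inter_insert_of_mem haQ, Finset.card_insert_of_notMem ha,
      Finset.card_insert_of_notMem (fun h => ha (Finset.mem_inter.1 h).2)]
    omega
  constructor
  · intro h1 h2
    apply hstep
    rw [Finset.insert_eq_of_mem h2] at *
    by_cases h1' : c.1 ∈ participants X
    · rw [Finset.insert_eq_of_mem h1']
    · exact hnew _ h1 h1'
  · intro h2 h1
    apply hstep
    rw [Finset.insert_eq_of_mem (Finset.mem_insert_of_mem h1)] at *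
    by_cases h2' : c.2 ∈ participants X
    · rw [Finset.insert_eq_of_mem h2']
    · exact hnew _ h2 h2'

/-- A person who talks only to newcomers hears only from those. -/
theorem mem_of_callReach_of_newcomers
    (hp : ∀ X c Y, l = X ++ c :: Y →
      (c.1 = p → c.2 ∉ participants X) ∧ (c.2 = p → c.1 ∉ participants X))
    (h : CallReach l z p) : z = p ∨ (z, p) ∈ l ∨ (p, z) ∈ l := by
  -- Induct from the end: if the last call involves `p`, the partner is new and so knows only their
  -- own information.
  induction l using List.reverseRecOn with
  | nil => exact Or.inl h
  | append_singleton l c ih =>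
    have ih := ih fun X d Y hl => hp X d (Y ++ [c]) (by simp [hl])
    obtain ⟨y, hy, hyp⟩ := CallReach.append_iff.1 h
    simp only [CallReach] at hyp
    have hc := hp l c [] rfl
    rcases hyp with rfl | ⟨rfl, hcp⟩ | ⟨rfl, hcp⟩
    · rcases ih hy with h | h | h
      · exact Or.inl h
      · exact Or.inr (Or.inl (by simp [h]))
      · exact Or.inr (Or.inr (by simp [h]))
    · obtain rfl := eq_of_callReach_of_notMem_right (hc.2 hcp) hy
      exact Or.inr (Or.inl (by simp [← hcp]))
    · obtain rfl := eq_of_callReach_of_notMem_right (hc.1 hcp) hy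
      exact Or.inr (Or.inr (by simp [← hcp]))

end Participants

end TemporalGraph

/-! ### The lower bound for sources and sinks. -/

namespace TemporalGraph

variable {V : Type*}

/-- `G` has no 4-cycle as a subgraph. -/
def FourCycleFree (G : SimpleGraph V) : Prop :=
  ∀ a b c d, G.Adj a b → G.Adj b c → G.Adj c d → G.Adj d a → a = c ∨ b = d

set_option maxHeartbeats 400000 in
open Classical in
/-- If `l` spreads the information of all sources in `U` to all sinks in `W`, then it has at least
`|U| + |W| - 4` calls, and at least `|U| + |W| - 3` of them if the graph has no 4-cycle. -/
theorem card_add_card_le (G : SimpleGraph V) (β : ℕ) (hβ : β = 4 ∨ β = 3 ∧ FourCycleFree G)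
    (U W : Finset V) (l : List (V × V)) (hU : U.Nonempty) (hW : W.Nonempty)
    (hadj : ∀ c ∈ l, G.Adj c.1 c.2) (hreach : ∀ u ∈ U, ∀ w ∈ W, CallReach l u w) :
    U.card + W.card ≤ l.length + β := by
  induction hn : U.card + W.card using Nat.strong_induction_on generalizing U W l with
  | _ n ih =>
  subst hn
  by_contra! hlt
  have hβ3 : 3 ≤ β := by omega
  obtain ⟨w₀, hw₀⟩ := hW
  have hUl : U.card ≤ l.length + 1 := by
    by_contra! h
    obtain ⟨A, hA, ⟨a, ha, haA⟩, b, hb, hbA⟩ := exists_callClosed_split _ _ h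
    exact hbA ((hA.reach (hreach b hb _ hw₀)).2 ((hA.reach (hreach a ha _ hw₀)).1 haA))
  have hU2 : 2 ≤ U.card := by
    -- A single source must be connected to all sinks, which takes `|W| - 1` calls; since `β ≥ 3`,
    -- this is no counterexample.
    obtain ⟨u₀, hu₀⟩ := hU
    by_contra! hU1
    have hWl : W.card ≤ l.length + 1 := by
      by_contra! h
      obtain ⟨A, hA, ⟨a, ha, haA⟩, b, hb, hbA⟩ := exists_callClosed_split _ _ h
      exact hbA ((hA.reach (hreach _ hu₀ b hb)).1 ((hA.reach (hreach _ hu₀ a ha)).2 haA))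
    omega
  have hcard := card_membersIn_add U
  -- A scheme that is cut into an early part `F` and a late part `L`, where `F` does not connect
  -- the sources in `A` with those outside `A`.
  let Cut : List (V × V) → List (V × V) → Set V → Prop := fun F L A =>
    F.length + L.length = l.length ∧ (∀ c ∈ F ++ L, G.Adj c.1 c.2) ∧
      (∀ u ∈ U, ∀ w ∈ W, CallReach (F ++ L) u w) ∧ CallClosed F A ∧
      (∃ u ∈ U, u ∈ A) ∧ ∃ u ∈ U, u ∉ A
  have hcut : ∀ F L A, Cut F L A →
      (membersIn U A).card + W.card ≤ (callsIn F A).length + L.length + β := by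
    rintro F L A ⟨-, hFadj, hFL, hA, ⟨u, hu, huA⟩, v, hv, hvA⟩
    have hlt : (membersIn U A).card < U.card :=
      Finset.card_lt_card ⟨fun x hx => (mem_membersIn.1 hx).1,
        fun h => hvA (mem_membersIn.1 (h hv)).2⟩
    have := ih _ (by omega) (membersIn U A) W (callsIn F A ++ L)
      ⟨u, mem_membersIn.2 ⟨hu, huA⟩⟩ ⟨w₀, hw₀⟩
      (fun c hc => hFadj c (by
        rcases List.mem_append.1 hc with hc | hc
        · exact List.mem_append_left _ (mem_callsIn.1 hc).1
        · exact List.mem_append_right _ hc))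
      (fun x hx w hw => by
        rw [mem_membersIn] at hx
        exact CallReach.append_mono_left (fun z => hA.reach_callsIn hx.2) (hFL x hx.1 w hw)) rfl
    simpa using this
  have hcompl : ∀ F L A, Cut F L A → Cut F L Aᶜ := by
    rintro F L A ⟨h1, h2, h3, hA, ⟨u, hu, huA⟩, v, hv, hvA⟩
    exact ⟨h1, h2, h3, hA.compl, ⟨v, hv, hvA⟩, u, hu, fun h => h huA⟩
  -- Add the inductive bounds for `A` and its complement; `L` is counted twice, which the assumed
  -- shortness of `l` turns into a bound on `F`.
  have hcutlen : ∀ F L A, Cut F L A → F.length + 2 ≤ U.card := by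
    intro F L A h
    have h1 := hcut F L A h
    have h2 := hcut F L Aᶜ (hcompl F L A h)
    have h3 := hcard A
    have h4 := length_callsIn_add F A
    have h5 := h.1
    omega
  have hne : ∃ m F L A, Cut F L A ∧ F.length + 2 = U.card ∧
      (membersIn U A).card = m := by
    have hlen : (l.take (U.card - 2)).length = U.card - 2 := by
      rw [List.length_take]; omega
    obtain ⟨A, hA, h1, h2⟩ := exists_callClosed_split (l.take (U.card - 2)) U (by omega)
    refine ⟨_, l.take (U.card - 2), l.drop (U.card - 2), A, ⟨?_, ?_, ?_, hA, h1, h2⟩, by omega, rfl⟩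
    · rw [← List.length_append, List.take_append_drop]
    · rwa [List.take_append_drop]
    · rwa [List.take_append_drop]
  obtain ⟨F, L, A, hC, hFlen, hm⟩ := Nat.find_spec hne
  have hmin : ∀ F' L' A', Cut F' L' A' → F'.length + 2 = U.card →
      (membersIn U A).card ≤ (membersIn U A').card := by
    intro F' L' A' h h'
    rw [hm]
    exact Nat.find_min' hne ⟨F', L', A', h, h', rfl⟩
  clear hm
  have hC' := hcompl F L A hC
  -- As `F` has the extremal length, both inductive bounds are equalities.
  have hAlen : (callsIn F A).length + 1 = (membersIn U A).card ∧
      (callsIn F Aᶜ).length + 1 = (membersIn U Aᶜ).card ∧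
      L.length + β = W.card + 1 := by
    have h1 := hcut F L A hC
    have h2 := hcut F L Aᶜ hC'
    have h3 := hcard A
    have h4 := length_callsIn_add F A
    have h5 := hC.1
    omega
  obtain ⟨hFA, hFA', hLlen⟩ := hAlen
  -- A call not crossing `A` could be moved into `F`, giving a cut that is too long.
  have hcross : ∀ A, Cut F L A → ∀ X c Y, L = X ++ c :: Y → (∀ d ∈ X, CallDisjoint d c) →
      ¬ (c.1 ∈ A ↔ c.2 ∈ A) := by
    rintro A ⟨h1, h2, h3, h4, h5⟩ X c Y rfl hd hcA
    have := hcutlen (F ++ [c]) (X ++ Y) A ⟨by simp at h1 ⊢; omega, ?_, ?_, ?_, h5⟩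
    · simp at this; omega
    · intro d hd
      simp only [List.mem_append, List.mem_cons, List.not_mem_nil, or_false] at hd
      exact h2 d (by rcases hd with (h | h) | h | h <;> simp [h])
    · intro u hu w hw
      rw [List.append_assoc]
      exact CallReach.append_mono_right (fun z => CallReach.move_front (l := X) hd) (h3 u hu w hw)
    · intro d hd
      rcases List.mem_append.1 hd with hd | hd
      · exact h4 d hd
      · obtain rfl := List.mem_singleton.1 hd
        exact hcA
  -- A sink absent from `L` would have to hear from both sides of `A` during `F`.
  have hWL : W ⊆ participants L := by
    intro w hw
    by_contra hwL
    obtain ⟨-, -, h3, h4, ⟨u, hu, huA⟩, v, hv, hvA⟩ := hC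
    have key : ∀ u ∈ U, CallReach F u w := by
      intro u hu
      obtain ⟨z, hz, hzw⟩ := CallReach.append_iff.1 (h3 u hu w hw)
      rwa [← eq_of_callReach_of_notMem_right hwL hzw]
    exact hvA ((h4.reach (key v hv)).2 ((h4.reach (key u hu)).1 huA))
  have hWL' := Finset.card_le_card hWL
  rcases List.eq_nil_or_concat' (callsIn F A) with hnil | ⟨F₁, e, he⟩
  · -- A single source outside of all early calls would take part in all initial late calls.
    obtain ⟨h1, h2, h3, h4, ⟨u, hu, huA⟩, v, hv, hvA⟩ := hC
    have hcu : Cut F L {u} := by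
      refine ⟨h1, h2, h3, ?_, ⟨u, hu, rfl⟩, v, hv, fun h => hvA (by rwa [h])⟩
      intro c hc
      have hno : c.1 ∉ A := fun h => by simpa [hnil] using mem_callsIn.2 ⟨hc, h⟩
      have hno' : c.2 ∉ A := fun h => hno ((h4 c hc).2 h)
      have e1 : c.1 ≠ u := fun h => hno (h ▸ huA)
      have e2 : c.2 ≠ u := fun h => hno' (h ▸ huA)
      simp [e1, e2]
    have hM : MeetsInitial L {u} := by
      intro X c Y hL hd
      have := hcross _ hcu X c Y hL hd
      simp only [Set.mem_singleton_iff, Finset.mem_singleton] at this ⊢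
      tauto
    have hle := hM.card_le
    have : (({u} : Finset V) ∩ participants L).card ≤ 1 :=
      (Finset.card_le_card Finset.inter_subset_left).trans (by simp)
    omega
  have heA : e ∈ F ∧ e.1 ∈ A := mem_callsIn.1 (by rw [he]; simp)
  have heA' : e.2 ∈ A := (hC.2.2.2.1 e heA.1).1 heA.2
  have hM : MeetsInitial L {e.1, e.2} := by
    intro X c Y hL hd
    by_contra hno
    simp only [Finset.mem_insert, Finset.mem_singleton, not_or] at hno
    have hec : CallDisjoint e c :=
      ⟨Ne.symm hno.1.1, Ne.symm hno.2.1, Ne.symm hno.1.2, Ne.symm hno.2.2⟩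
    have hcA := hcross A hC X c Y hL hd
    obtain ⟨h1, h2, h3, h4, ⟨u, hu, huA⟩, v, hv, hvA⟩ := hC
    have hlenA : F₁.length + 2 = (membersIn U A).card := by
      rw [he] at hFA; simpa using hFA
    have hF₁ : ∀ d ∈ F₁, d.1 ∈ A ∧ d.2 ∈ A := by
      intro d hd
      have hd' : d ∈ callsIn F A := by rw [he]; simp [hd]
      rw [mem_callsIn] at hd'
      exact ⟨hd'.2, (h4 d hd'.1).1 hd'.2⟩
    -- A part of `A` which the call `c` does not touch.
    obtain ⟨A', hA'sub, hA'F, hcA1, hcA2, ⟨a, haU, haA'⟩, b, hbU, hbA'⟩ :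
        ∃ A' ⊆ A, CallClosed F₁ A' ∧ c.1 ∉ A' ∧ c.2 ∉ A' ∧ (∃ a ∈ membersIn U A, a ∈ A') ∧
          ∃ b ∈ membersIn U A, b ∉ A' := by
      have key := exists_callClosed_subset hF₁ (T := membersIn U A)
        (fun x hx => (mem_membersIn.1 hx).2) (by omega)
      by_cases hc1 : c.1 ∈ A
      · have hc2 : c.2 ∉ A := fun h => hcA (iff_of_true hc1 h)
        obtain ⟨A', h, h', h'', h'''⟩ := key c.1
        exact ⟨A', h, h', h'', fun hc => hc2 (h hc), h'''⟩
      · obtain ⟨A', h, h', h'', h'''⟩ := key c.2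
        exact ⟨A', h, h', fun hc => hc1 (h hc), h'', h'''⟩
    rw [mem_membersIn] at haU hbU
    have hsum := length_callsIn_add F A
    rw [he] at hsum
    simp only [List.length_append, List.length_singleton] at hsum
    -- Trade `e` for `c`: put the calls inside `A` last in the early part, then let `c` overtake
    -- both `e` and `X`. The length is unchanged but the cut contains fewer sources.
    have hcut' : Cut (callsIn F Aᶜ ++ F₁ ++ [c]) (e :: (X ++ Y)) A' := by
      refine ⟨?_, ?_, ?_, ?_, ⟨a, haU.1, haA'⟩, b, hbU.1, hbA'⟩
      · rw [hL] at h1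
        simp at h1 ⊢
        omega
      · intro d hd
        apply h2 d
        have hmem : d ∈ callsIn F Aᶜ ∨ d ∈ callsIn F A ∨ d ∈ L := by
          rw [he, hL]
          simp only [List.mem_append, List.mem_cons, List.not_mem_nil, or_false] at hd
          rcases hd with ((h | h) | h) | h | h | h <;> simp [h]
        rcases hmem with h | h | h
        · exact List.mem_append_left _ (mem_callsIn.1 h).1
        · exact List.mem_append_left _ (mem_callsIn.1 h).1
        · exact List.mem_append_right _ h
      · intro x hx w hw
        have hr := CallReach.append_mono_left (fun z => h4.reach_reorder) (h3 x hx w hw)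
        rw [he, hL, show callsIn F Aᶜ ++ (F₁ ++ [e]) ++ (X ++ c :: Y) =
          (callsIn F Aᶜ ++ F₁) ++ ((e :: X) ++ c :: Y) by simp] at hr
        rw [show callsIn F Aᶜ ++ F₁ ++ [c] ++ e :: (X ++ Y) =
          (callsIn F Aᶜ ++ F₁) ++ c :: ((e :: X) ++ Y) by simp]
        refine CallReach.append_mono_right (fun z => CallReach.move_front (l := e :: X) ?_) hr
        intro d hd'
        rcases List.mem_cons.1 hd' with rfl | hd'
        · exact hec
        · exact hd d hd'
      · intro d hd'
        simp only [List.mem_append, List.mem_singleton] at hd'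
        rcases hd' with (hd' | hd') | rfl
        · rw [mem_callsIn] at hd'
          have hd2 : d.2 ∉ A := fun h => hd'.2 ((h4 d hd'.1).2 h)
          exact iff_of_false (fun h => hd'.2 (hA'sub h)) (fun h => hd2 (hA'sub h))
        · exact hA'F d hd'
        · exact iff_of_false hcA1 hcA2
    have hle := hmin _ _ _ hcut' (by simp; omega)
    have hlt' : (membersIn U A').card < (membersIn U A).card := by
      apply Finset.card_lt_card
      refine ⟨fun x hx => ?_, fun h => ?_⟩
      · rw [mem_membersIn] at hx ⊢
        exact ⟨hx.1, hA'sub hx.2⟩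
      · exact hbA' (mem_membersIn.1 (h (mem_membersIn.2 hbU))).2
    omega
  have hQ : ({e.1, e.2} : Finset V).card ≤ 2 := Finset.card_le_two
  have hML := hM.card_le
  have hQ' : (({e.1, e.2} : Finset V) ∩ participants L).card ≤ ({e.1, e.2} : Finset V).card :=
    Finset.card_le_card Finset.inter_subset_left
  obtain rfl | ⟨rfl, hfree⟩ := hβ
  · omega
  have hWeq : W = participants L := Finset.eq_of_subset_of_card_le hWL (by omega)
  have hQeq : ({e.1, e.2} : Finset V) ∩ participants L = {e.1, e.2} :=
    Finset.eq_of_subset_of_card_le Finset.inter_subset_left (by omega)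
  have hnew : ∀ X c Y, L = X ++ c :: Y →
      (c.1 ∈ ({e.1, e.2} : Finset V) → c.2 ∉ participants X) ∧
        (c.2 ∈ ({e.1, e.2} : Finset V) → c.1 ∉ participants X) := by
    rintro X c Y rfl
    simp only [List.length_append, List.length_cons] at hLlen hML
    exact hM.notMem_of_tight (by omega)
  -- The people outside `A` from whom `p` hears in the late part.
  let D : V → Set V := fun p => {z | z ∉ A ∧ ((z, p) ∈ L ∨ (p, z) ∈ L)}
  have hD : ∀ p ∈ ({e.1, e.2} : Finset V), ∀ x ∈ membersIn U Aᶜ,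
      ∃ z ∈ D p, CallReach (callsIn F Aᶜ) x z := by
    intro p hp x hx
    have hpA : p ∈ A := by
      simp only [Finset.mem_insert, Finset.mem_singleton] at hp
      rcases hp with rfl | rfl
      · exact heA.2
      · exact heA'
    have hpW : p ∈ W := by
      rw [← hQeq] at hp
      rw [hWeq]
      exact (Finset.mem_inter.1 hp).2
    rw [mem_membersIn] at hx
    obtain ⟨z, hz, hzp⟩ := CallReach.append_iff.1 (hC.2.2.1 x hx.1 p hpW)
    have hzA : z ∉ A := (hC.2.2.2.1.compl.reach hz).1 hx.2
    refine ⟨z, ⟨hzA, ?_⟩, hC.2.2.2.1.compl.reach_callsIn hx.2 hz⟩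
    refine (mem_of_callReach_of_newcomers (fun X c Y hL => ?_) hzp).resolve_left
      (fun h => hzA (h ▸ hpA))
    exact ⟨fun h => (hnew X c Y hL).1 (h ▸ hp), fun h => (hnew X c Y hL).2 (h ▸ hp)⟩
  have hene : e.1 ≠ e.2 := (hC.2.1 e (List.mem_append_left _ heA.1)).ne
  -- A common partner would no longer be a newcomer in the later of the two calls.
  have hdisj : Disjoint (D e.1) (D e.2) := by
    rw [Set.disjoint_left]
    rintro z ⟨hzA, hz1⟩ ⟨-, hz2⟩
    have hz : ∀ p ∈ ({e.1, e.2} : Finset V), ∀ X c Y, L = X ++ c :: Y →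
        (c = (z, p) ∨ c = (p, z)) → z ∉ participants X := by
      rintro p hp X c Y hL (rfl | rfl)
      · exact (hnew X _ Y hL).2 hp
      · exact (hnew X _ Y hL).1 hp
    obtain ⟨c₁, hc₁, hc₁'⟩ : ∃ c ∈ L, c = (z, e.1) ∨ c = (e.1, z) := by
      rcases hz1 with h | h
      exacts [⟨_, h, Or.inl rfl⟩, ⟨_, h, Or.inr rfl⟩]
    obtain ⟨c₂, hc₂, hc₂'⟩ : ∃ c ∈ L, c = (z, e.2) ∨ c = (e.2, z) := by
      rcases hz2 with h | h
      exacts [⟨_, h, Or.inl rfl⟩, ⟨_, h, Or.inr rfl⟩]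
    have hzc₁ : z = c₁.1 ∨ z = c₁.2 := by rcases hc₁' with rfl | rfl <;> simp
    have hzc₂ : z = c₂.1 ∨ z = c₂.2 := by rcases hc₂' with rfl | rfl <;> simp
    have hcc : c₁ ≠ c₂ := by
      have : z ≠ e.1 := fun h => hzA (h ▸ heA.2)
      have : z ≠ e.2 := fun h => hzA (h ▸ heA')
      rintro rfl
      rcases hc₁' with rfl | rfl <;> rcases hc₂' with h | h <;> simp_all
    obtain ⟨X, Y, hL⟩ := List.append_of_mem hc₂
    have hmem : c₁ ∈ X ∨ c₁ ∈ Y := by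
      rw [hL] at hc₁
      simpa [hcc] using hc₁
    rcases hmem with h | h
    · exact hz e.2 (by simp) X c₂ Y hL hc₂' (mem_participants.2 ⟨c₁, h, hzc₁⟩)
    · obtain ⟨Y₁, Y₂, rfl⟩ := List.append_of_mem h
      exact hz e.1 (by simp) (X ++ c₂ :: Y₁) c₁ Y₂ (by simp [hL]) hc₁'
        (mem_participants.2 ⟨c₂, by simp, hzc₂⟩)
  obtain ⟨c, hcF, hc⟩ := exists_call_between (callsIn F Aᶜ) (membersIn U Aᶜ)
    (D e.1) (D e.2) hdisj (by omega) (hD e.1 (by simp)) (hD e.2 (by simp))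
  have hcadj : G.Adj c.1 c.2 := hC.2.1 c (List.mem_append_left _ (mem_callsIn.1 hcF).1)
  have headj : G.Adj e.1 e.2 := hC.2.1 e (List.mem_append_left _ heA.1)
  have hDadj : ∀ p, ∀ z ∈ D p, G.Adj z p := by
    rintro p z ⟨-, h | h⟩
    · exact hC.2.1 _ (List.mem_append_right _ h)
    · exact (hC.2.1 _ (List.mem_append_right _ h)).symm
  obtain ⟨z₁, z₂, hz₁, hz₂, hzadj⟩ : ∃ z₁ z₂, z₁ ∈ D e.1 ∧ z₂ ∈ D e.2 ∧ G.Adj z₁ z₂ := by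
    rcases hc with ⟨h1, h2⟩ | ⟨h1, h2⟩
    exacts [⟨_, _, h1, h2, hcadj⟩, ⟨_, _, h2, h1, hcadj.symm⟩]
  rcases hfree e.1 e.2 z₂ z₁ headj (hDadj _ _ hz₂).symm hzadj.symm (hDadj _ _ hz₁) with h | h
  · exact hz₂.1 (h ▸ heA.2)
  · exact hz₁.1 (h ▸ heA')

end TemporalGraph

namespace TemporalGraph

variable {V : Type*} {G : SimpleGraph V}

/-! ### From labelings to calls. -/

section LabelingToCalls

theorem CallReach.of_forall₂_active {lam : Labeling G} {layer : ℕ → List (V × V)}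
    (hlayer : ∀ t x y, lam.Active s(x, y) t → (x, y) ∈ layer t ∨ (y, x) ∈ layer t)
    {ts ts' : List ℕ} {u v : V} (p : G.Walk u v) (h : List.Forall₂ lam.Active p.edges ts)
    (hsub : ts.Sublist ts') : CallReach (ts'.flatMap layer) u v := by
  induction ts' generalizing u ts with
  | nil =>
    obtain rfl := List.sublist_nil.1 hsub
    cases p with
    | nil => rfl
    | cons hadj p => simp at h
  | cons t ts' ih =>
    rw [List.flatMap_cons]
    cases hsub with
    | cons _ hsub => exact (ih p h hsub).append_right
    | cons_cons _ hsub =>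
      cases p with
      | nil => simp at h
      | cons hadj p =>
        rw [SimpleGraph.Walk.edges_cons, List.forall₂_cons] at h
        refine CallReach.append_iff.2 ⟨_, ?_, ih p h.2 hsub⟩
        rcases hlayer _ _ _ h.1 with h | h
        exacts [CallReach.of_mem h, CallReach.of_mem_symm h]

/-- The labels of a labeling of finite cost, listed by time, form a sequence of calls in which all
information travels that travels along temporal paths. -/
theorem exists_calls_of_labeling [Fintype G.edgeSet] (lam : Labeling G) {k : ℕ}
    (hcost : lam.cost ≤ k) : ∃ l : List (V × V), l.length ≤ k ∧ (∀ c ∈ l, G.Adj c.1 c.2) ∧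
      ∀ u v, Reachable lam u v → CallReach l u v := by
  classical
  have hfin : ∀ e, (lam e).Finite := fun e =>
    Set.finite_of_encard_le_coe
      ((Finset.single_le_sum (f := fun e => (lam e).encard) (fun _ _ => zero_le)
        (Finset.mem_univ e)).trans hcost)
  let S : G.edgeSet → Finset ℕ := fun e => (hfin e).toFinset
  have hS : ∑ e, (S e).card ≤ k := by
    have h : ((∑ e, (S e).card : ℕ) : ℕ∞) ≤ k := by
      push_cast
      refine le_trans (le_of_eq (Finset.sum_congr rfl fun e _ => ?_)) hcost
      exact (hfin e).encard_eq_coe_toFinset_card.symm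
    exact_mod_cast h
  obtain ⟨T, hT⟩ : ∃ T, ∀ e, ∀ t ∈ S e, t < T := by
    refine ⟨(Finset.univ.biUnion S).sup id + 1, fun e t ht => Nat.lt_succ_of_le ?_⟩
    exact Finset.le_sup (f := id) (Finset.mem_biUnion.2 ⟨e, Finset.mem_univ e, ht⟩)
  -- The order and orientation of simultaneous calls are arbitrary: extra spreading is harmless,
  -- since only temporal reachability has to be preserved.
  let layer : ℕ → List (V × V) := fun t =>
    (Finset.univ.filter fun e => t ∈ S e).toList.map fun e => Quot.out e.1
  have hout : ∀ e : Sym2 V, s((Quot.out e).1, (Quot.out e).2) = e := fun e => Quot.out_eq e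
  refine ⟨(List.range T).flatMap layer, ?_, ?_, ?_⟩
  · refine le_trans (le_of_eq ?_) hS
    have h1 : ((List.range T).flatMap layer).length =
        ∑ t ∈ Finset.range T, (Finset.univ.filter fun e => t ∈ S e).card := by
      rw [List.length_flatMap, Finset.sum_range, ← List.sum_ofFn]
      congr 1
      apply List.ext_getElem <;> simp [layer]
    rw [h1]
    refine (Finset.sum_card_bipartiteAbove_eq_sum_card_bipartiteBelow
      (s := (Finset.univ : Finset G.edgeSet)) (fun e t => t ∈ S e)).symm.trans ?_
    refine Finset.sum_congr rfl fun e _ => congrArg _ ?_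
    ext t
    simp only [Finset.mem_bipartiteAbove, Finset.mem_range]
    exact ⟨fun h => h.2, fun h => ⟨hT e t h, h⟩⟩
  · intro c hc
    simp only [layer, List.mem_flatMap, List.mem_map] at hc
    obtain ⟨t, -, e, -, rfl⟩ := hc
    rw [← SimpleGraph.mem_edgeSet, hout]
    exact e.2
  · rintro u v ⟨p, ts, hp⟩
    refine CallReach.of_forall₂_active (lam := lam) ?_ p hp.active ?_
    · rintro t x y ⟨he, ht⟩
      have hmem : Quot.out s(x, y) ∈ layer t := by
        simp only [layer, List.mem_map, Finset.mem_toList, Finset.mem_filter, Finset.mem_univ,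
          true_and]
        exact ⟨⟨s(x, y), he⟩, (hfin _).mem_toFinset.2 ht, rfl⟩
      have hxy := hout s(x, y)
      rw [Sym2.eq_iff] at hxy
      rcases hxy with ⟨h1, h2⟩ | ⟨h1, h2⟩
      · left; convert hmem using 1; exact Prod.ext h1.symm h2.symm
      · right; convert hmem using 1; exact Prod.ext h1.symm h2.symm
    · have hlt : ∀ t ∈ ts, t < T := by
        intro t ht
        obtain ⟨i, hi, rfl⟩ := List.getElem_of_mem ht
        have hi' : i < p.edges.length := by rw [hp.active.length_eq]; exact hi
        obtain ⟨he, ht⟩ := hp.active.get hi' hi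
        exact hT _ _ ((hfin _).mem_toFinset.2 ht)
      refine List.sublist_of_subperm_of_pairwise (r := (· < ·)) ?_ hp.strictlyIncreasing
        List.pairwise_lt_range
      exact List.subperm_of_subset (hp.strictlyIncreasing.imp fun h => h.ne)
        fun t ht => List.mem_range.2 (hlt t ht)

end LabelingToCalls

/-! ### From calls to labelings. -/

section CallsToLabeling

/-- If `u` already lies on the path, prepending the edge would revisit it; the tail of the path from
`u` serves instead. -/
theorem exists_temporalPath_cons {lam : Labeling G} {u x v : V} {i : ℕ} (hadj : G.Adj u x)
    (hact : lam.Active s(u, x) i)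
    (h : ∃ (p : G.Walk x v) (ts : List ℕ), IsTemporalPath lam p ts ∧ ∀ t ∈ ts, i + 1 ≤ t) :
    ∃ (p : G.Walk u v) (ts : List ℕ), IsTemporalPath lam p ts ∧ ∀ t ∈ ts, i ≤ t := by
  classical
  obtain ⟨p, ts, ⟨hp, hts, hpt⟩, hle⟩ := h
  by_cases hu : u ∈ p.support
  · refine ⟨p.dropUntil u hu, ts.drop (p.takeUntil u hu).edges.length,
      ⟨hp.dropUntil hu, hts.sublist (List.drop_sublist _ _), ?_⟩, fun t ht => ?_⟩
    · have hedges : p.edges = (p.takeUntil u hu).edges ++ (p.dropUntil u hu).edges := by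
        rw [← SimpleGraph.Walk.edges_append, SimpleGraph.Walk.take_spec]
      have h := List.forall₂_drop (p.takeUntil u hu).edges.length hpt
      rwa [hedges, List.drop_left] at h
    · exact (Nat.le_succ i).trans (hle t (List.mem_of_mem_drop ht))
  · refine ⟨SimpleGraph.Walk.cons hadj p, i :: ts, ⟨hp.cons hu, ?_, ?_⟩, ?_⟩
    · exact List.pairwise_cons.2 ⟨fun t ht => hle t ht, hts⟩
    · exact List.Forall₂.cons hact hpt
    · intro t ht
      rcases List.mem_cons.1 ht with rfl | ht
      · exact le_rfl
      · exact (Nat.le_succ i).trans (hle t ht)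

theorem CallReach.exists_temporalPath {lam : Labeling G} {l : List (V × V)} {i : ℕ} {u v : V}
    (hadj : ∀ c ∈ l, G.Adj c.1 c.2)
    (hact : ∀ j c, l[j]? = some c → lam.Active s(c.1, c.2) (i + j)) (h : CallReach l u v) :
    ∃ (p : G.Walk u v) (ts : List ℕ), IsTemporalPath lam p ts ∧ ∀ t ∈ ts, i ≤ t := by
  induction l generalizing i u with
  | nil =>
    obtain rfl : u = v := h
    exact ⟨.nil, [], ⟨.nil, List.Pairwise.nil, List.Forall₂.nil⟩, by simp⟩
  | cons c l ih =>
    have hadj' : ∀ c ∈ l, G.Adj c.1 c.2 := fun c hc => hadj c (by simp [hc])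
    have hact' : ∀ j c, l[j]? = some c → lam.Active s(c.1, c.2) (i + 1 + j) := by
      intro j c hc
      rw [add_assoc, add_comm 1 j]
      exact hact (j + 1) c (by simpa using hc)
    have hc := hact 0 c (by simp)
    have hcadj := hadj c (by simp)
    rcases h with h | ⟨rfl, h⟩ | ⟨rfl, h⟩
    · obtain ⟨p, ts, hp, hle⟩ := ih hadj' hact' h
      exact ⟨p, ts, hp, fun t ht => (Nat.le_succ i).trans (hle t ht)⟩
    · exact exists_temporalPath_cons hcadj hc (ih hadj' hact' h)
    · exact exists_temporalPath_cons hcadj.symm (by rwa [Sym2.eq_swap]) (ih hadj' hact' h)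

/-- A sequence of calls along edges that spreads all information gives a labeling of the same cost:
the `i`-th call puts the label `i` on its edge. -/
theorem minLabelingYes_of_calls [Fintype G.edgeSet] (l : List (V × V))
    (hadj : ∀ c ∈ l, G.Adj c.1 c.2) (hreach : ∀ u v, CallReach l u v) :
    MinLabelingYes G l.length := by
  classical
  let S : G.edgeSet → Finset ℕ := fun e =>
    (Finset.range l.length).filter fun i => ∃ c, l[i]? = some c ∧ s(c.1, c.2) = e.1
  refine ⟨fun e => S e, fun u v _ => ?_, ?_⟩
  · have hact : ∀ j c, l[j]? = some c →
        Labeling.Active (G := G) (fun e => (S e : Set ℕ)) s(c.1, c.2) (0 + j) := by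
      intro j c hc
      obtain ⟨hj, -⟩ := List.getElem?_eq_some_iff.1 hc
      refine ⟨hadj c (List.mem_of_getElem? hc), ?_⟩
      simp only [S, Finset.coe_filter, Finset.mem_range, Set.mem_ofPred_eq, zero_add]
      exact ⟨hj, c, hc, rfl⟩
    obtain ⟨p, ts, hp, -⟩ := CallReach.exists_temporalPath hadj hact (hreach u v)
    exact ⟨p, ts, hp⟩
  · have h : ∑ e, (S e).card ≤ l.length := by
      rw [← Finset.card_biUnion]
      · refine le_trans (Finset.card_le_card (t := Finset.range l.length) ?_) (by simp)
        exact Finset.biUnion_subset.2 fun e _ => Finset.filter_subset _ _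
      · intro e _ e' _ hne
        rw [Function.onFun, Finset.disjoint_left]
        intro i hi hi'
        obtain ⟨c, hc, hce⟩ := (Finset.mem_filter.1 hi).2
        obtain ⟨c', hc', hce'⟩ := (Finset.mem_filter.1 hi').2
        rw [hc, Option.some_inj] at hc'
        subst hc'
        exact hne (Subtype.ext (hce.symm.trans hce'))
    simp only [Labeling.cost, Set.encard_coe_eq_coe_finsetCard]
    exact_mod_cast h

end CallsToLabeling

/-! ### Constructions for the upper bounds. -/

section UpperBound

variable [Fintype V]

/-- Calls that spread all information within `S` extend to the whole connected graph, at the price of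
two calls for every further vertex. -/
theorem exists_calls_of_subset (hG : G.Connected) (S : Finset V) (hS : S.Nonempty)
    (l : List (V × V)) (hadj : ∀ c ∈ l, G.Adj c.1 c.2)
    (hreach : ∀ u ∈ S, ∀ v ∈ S, CallReach l u v) :
    ∃ l' : List (V × V), l'.length = l.length + 2 * (Fintype.card V - S.card) ∧
      (∀ c ∈ l', G.Adj c.1 c.2) ∧ ∀ u v, CallReach l' u v := by
  classical
  induction hn : Fintype.card V - S.card generalizing S l with
  | zero =>
    have hSu : S = Finset.univ := by
      rw [← Finset.card_eq_iff_eq_univ]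
      have := S.card_le_univ
      omega
    subst hSu
    exact ⟨l, rfl, hadj, fun u v => hreach u (by simp) v (by simp)⟩
  | succ n ih =>
    obtain ⟨x, hx⟩ : ∃ x, x ∉ S := by
      by_contra! h
      have : S = Finset.univ := Finset.eq_univ_iff_forall.2 h
      rw [this, Finset.card_univ] at hn
      omega
    obtain ⟨y, hy⟩ := hS
    obtain ⟨p⟩ := hG.preconnected y x
    obtain ⟨d, -, hdS, hdS'⟩ := p.exists_boundary_dart (S : Set V) hy hx
    obtain ⟨⟨s, v⟩, hsv⟩ := d
    simp only [Finset.mem_coe] at hdS hdS'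
    have hcard : (insert v S).card = S.card + 1 := Finset.card_insert_of_notMem hdS'
    -- The new vertex `v` hands its information to `s` before `l` and collects everything from `s`
    -- after `l`.
    obtain ⟨l', hl', hadj', hreach'⟩ := ih (insert v S) ⟨v, by simp⟩ ((v, s) :: (l ++ [(v, s)]))
      (by
        intro c hc
        simp only [List.mem_cons, List.mem_append, List.not_mem_nil, or_false] at hc
        rcases hc with rfl | hc | rfl
        exacts [hsv.symm, hadj c hc, hsv.symm])
      (by
        have key : ∀ u ∈ S, ∀ w ∈ insert v S, CallReach (l ++ [(v, s)]) u w := by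
          intro u hu w hw
          rcases Finset.mem_insert.1 hw with rfl | hw
          · exact CallReach.append_iff.2
              ⟨s, hreach u hu s hdS, CallReach.of_mem_symm (by simp)⟩
          · exact (hreach u hu w hw).append_left
        intro u hu w hw
        rcases Finset.mem_insert.1 hu with rfl | hu
        · exact Or.inr (Or.inl ⟨rfl, key s hdS w hw⟩)
        · exact Or.inl (key u hu w hw))
      (by omega)
    refine ⟨l', ?_, hadj', hreach'⟩
    simp at hl'
    omega

theorem minLabelingYes_of_connected [Fintype G.edgeSet] (hG : G.Connected)
    (hcard : 2 ≤ Fintype.card V) : MinLabelingYes G (2 * Fintype.card V - 3) := by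
  classical
  have : Nontrivial V := Fintype.one_lt_card_iff_nontrivial.1 hcard
  obtain ⟨x⟩ := hG.nonempty
  obtain ⟨y, hxy⟩ := hG.preconnected.exists_adj_of_nontrivial x
  obtain ⟨l, hl, hadj, hreach⟩ := exists_calls_of_subset hG {x, y} (by simp) [(x, y)]
    (by simpa using hxy)
    (by
      intro u hu v hv
      simp only [Finset.mem_insert, Finset.mem_singleton] at hu hv
      rcases hu with rfl | rfl <;> rcases hv with rfl | rfl <;> simp [CallReach])
  rw [Finset.card_pair hxy.ne] at hl
  have := minLabelingYes_of_calls l hadj hreach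
  rwa [hl, List.length_singleton,
    show 1 + 2 * (Fintype.card V - 2) = 2 * Fintype.card V - 3 by omega] at this

theorem minLabelingYes_of_fourCycle [Fintype G.edgeSet] (hG : G.Connected) {a b c d : V}
    (hab : G.Adj a b) (hbc : G.Adj b c) (hcd : G.Adj c d) (hda : G.Adj d a) (hac : a ≠ c)
    (hbd : b ≠ d) : MinLabelingYes G (2 * Fintype.card V - 4) := by
  classical
  have hcard : ({a, b, c, d} : Finset V).card = 4 := by
    rw [Finset.card_insert_of_notMem (by simp [hab.ne, hac, hda.ne']),
      Finset.card_insert_of_notMem (by simp [hbc.ne, hbd]), Finset.card_pair hcd.ne]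
  -- Two opposite edges pool information in pairs; either of the other two edges then joins the
  -- pairs.
  obtain ⟨l, hl, hadj, hreach⟩ := exists_calls_of_subset hG {a, b, c, d} (by simp)
    [(a, b), (c, d), (b, c), (d, a)]
    (by simp [hab, hbc, hcd, hda])
    (by
      intro u hu v hv
      simp only [Finset.mem_insert, Finset.mem_singleton] at hu hv
      rcases hu with rfl | rfl | rfl | rfl <;> rcases hv with rfl | rfl | rfl | rfl <;>
        simp [CallReach])
  have h4 : 4 ≤ Fintype.card V := hcard ▸ Finset.card_le_univ _
  rw [hcard] at hl
  have := minLabelingYes_of_calls l hadj hreach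
  rwa [hl, show [(a, b), (c, d), (b, c), (d, a)].length + 2 * (Fintype.card V - 4) =
    2 * Fintype.card V - 4 by simp; omega] at this

end UpperBound

/-! ### Assembling the bounds. -/

theorem two_mul_card_le_of_minLabelingYes [Fintype V] [Fintype G.edgeSet] [Nonempty V] {k β : ℕ}
    (hβ : β = 4 ∨ β = 3 ∧ FourCycleFree G) (h : MinLabelingYes G k) :
    2 * Fintype.card V ≤ k + β := by
  obtain ⟨lam, hlam, hcost⟩ := h
  obtain ⟨l, hl, hadj, hreach⟩ := exists_calls_of_labeling lam hcost
  have := card_add_card_le G β hβ Finset.univ Finset.univ l Finset.univ_nonempty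
    Finset.univ_nonempty hadj (fun u _ v _ => by
      by_cases huv : u = v
      · exact huv ▸ CallReach.refl _ _
      · exact hreach u v (hlam u v huv))
  rw [Finset.card_univ] at this
  omega

theorem isContained_cycleGraph_four_iff :
    (SimpleGraph.cycleGraph 4).IsContained G ↔ ∃ a b c d, G.Adj a b ∧ G.Adj b c ∧ G.Adj c d ∧
      G.Adj d a ∧ a ≠ c ∧ b ≠ d := by
  constructor
  · rintro ⟨f⟩
    have hadj : ∀ i j, (SimpleGraph.cycleGraph 4).Adj i j → G.Adj (f i) (f j) :=
      fun i j h => f.toHom.map_adj h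
    refine ⟨f 0, f 1, f 2, f 3, hadj _ _ ?_, hadj _ _ ?_, hadj _ _ ?_, hadj _ _ ?_,
      f.injective.ne ?_, f.injective.ne ?_⟩ <;> decide
  · rintro ⟨a, b, c, d, hab, hbc, hcd, hda, hac, hbd⟩
    have hinj : Function.Injective ![a, b, c, d] := by
      intro i j hij
      fin_cases i <;> fin_cases j <;> simp_all [hab.ne, hbc.ne, hcd.ne, hda.ne]
    refine ⟨⟨⟨![a, b, c, d], ?_⟩, hinj⟩⟩
    intro i j hij
    fin_cases i <;> fin_cases j <;> first
      | exact absurd hij (by decide)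
      | assumption
      | (apply SimpleGraph.Adj.symm; assumption)

end TemporalGraph

theorem theorem1 {V : Type*} [Fintype V] (G : SimpleGraph V) [Fintype G.edgeSet]
    (hconn : G.Connected) (hcard : 2 ≤ Fintype.card V) :
    ((SimpleGraph.cycleGraph 4).IsContained G →
      IsLeast {k : ℕ | TemporalGraph.MinLabelingYes G k} (2 * Fintype.card V - 4)) ∧
    (¬ (SimpleGraph.cycleGraph 4).IsContained G →
      IsLeast {k : ℕ | TemporalGraph.MinLabelingYes G k} (2 * Fintype.card V - 3)) := by
  have : Nonempty V := hconn.nonempty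
  rw [TemporalGraph.isContained_cycleGraph_four_iff]
  constructor
  · rintro ⟨a, b, c, d, hab, hbc, hcd, hda, hac, hbd⟩
    refine ⟨TemporalGraph.minLabelingYes_of_fourCycle hconn hab hbc hcd hda hac hbd, fun k hk => ?_⟩
    have := TemporalGraph.two_mul_card_le_of_minLabelingYes (β := 4) (Or.inl rfl) hk
    omega
  · intro hno
    refine ⟨TemporalGraph.minLabelingYes_of_connected hconn hcard, fun k hk => ?_⟩
    have hfree : TemporalGraph.FourCycleFree G := by
      intro a b c d hab hbc hcd hda
      by_contra! h
      exact hno ⟨a, b, c, d, hab, hbc, hcd, hda, h⟩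
    have := TemporalGraph.two_mul_card_le_of_minLabelingYes (β := 3) (Or.inr ⟨rfl, hfree⟩) hk
    omega
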